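/- Let $K$ be an algebraically closed field (of any characteristic), let $R=K[x_1,\dots,x_N]$ be a polynomial ring, and let $V=V_1\oplus\cdots\oplus V_d$ be a $K$-vector subspace of $R$ of finite dimension $n$, where $V_i$ consists of forms of degree $i$ (together with $0$). Let $F_1,\dots,F_n$ be a basis of $V$ consisting of homogeneous elements, and assume that $F_1,\dots,F_n$ is a regular sequence in $R$. For a set $\sigma\subseteq R$ of polynomials let $\mathcal{V}(\sigma)$ be the closed subscheme of $\mathbb{A}^N_K$ defined by the vanishing of the elements of $\sigma$, that is, $\operatorname{Spec} R/(\sigma)R$. Its singular locus is the set of points $x\in K^N$ at which all elements of $\sigma$ vanish and at which the local ring of $R/(\sigma)R$ is not a regular local ring. The codimension in $\mathbb{A}^N_K$ of a set of points is the height of the ideal of all polynomials vanishing on it; the empty set has codimension $+\infty$. Let $S$ be the family of all subsets of $V$ that consist of nonzero forms with mutually distinct degrees, and for $\sigma\in S$ let $C_\sigma$ be the codimension in $\mathbb{A}^N_K$ of the singular locus of $\mathcal{V}(\sigma)$. Let $X=\mathcal{V}(F_1,\dots,F_n)$. Then the codimension in $\mathbb{A}^N_K$ of the singular locus of $X$ is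 at least $$\Bigl(\min_{\sigma\in S} C_\sigma\Bigr)-(n-1).$$ -/

import Mathlib

namespace SmallSubalgebras

open MvPolynomial

variable {K : Type*} [Field K] {N : ℕ}

/-- Evaluation at a point `x` of the zero set of `I`, as a homomorphism from the coordinate
ring `K[x₁, …, x_N] / I` of the closed subscheme defined by `I`. -/
noncomputable def evalAt (I : Ideal (MvPolynomial (Fin N) K)) (x : Fin N → K)
    (hx : x ∈ zeroLocus K I) :
    (MvPolynomial (Fin N) K ⧸ I) →+* K :=
  Ideal.Quotient.lift I (aeval x : MvPolynomial (Fin N) K →ₐ[K] K).toRingHom hx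

/-- The maximal ideal of the coordinate ring `K[x₁, …, x_N] / I` that belongs to the point `x`. -/
noncomputable def pointIdeal (I : Ideal (MvPolynomial (Fin N) K)) (x : Fin N → K)
    (hx : x ∈ zeroLocus K I) : Ideal (MvPolynomial (Fin N) K ⧸ I) :=
  RingHom.ker (evalAt I x hx)

instance pointIdeal_isPrime (I : Ideal (MvPolynomial (Fin N) K)) (x : Fin N → K)
    (hx : x ∈ zeroLocus K I) : (pointIdeal I x hx).IsPrime :=
  RingHom.ker_isPrime (evalAt I x hx)

/-- The local ring at the point `x` of the closed subscheme of affine `N`-space defined by `I`. -/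
abbrev localRingAt (I : Ideal (MvPolynomial (Fin N) K)) (x : Fin N → K)
    (hx : x ∈ zeroLocus K I) : Type _ :=
  Localization.AtPrime (pointIdeal I x hx)

/-- The singular locus of the closed subscheme `Spec (K[x₁, …, x_N] / I)` of affine `N`-space,
as a set of closed points (`K` being algebraically closed): the points of the zero set of `I`
at which the local ring of the subscheme is not a regular local ring. -/
def singularLocus (I : Ideal (MvPolynomial (Fin N) K)) : Set (Fin N → K) :=
  {x | ∃ hx : x ∈ zeroLocus K I, ¬ IsRegularLocalRing (localRingAt I x hx)}

/-- The codimension in affine `N`-space of (the Zariski closure of) a set `Z` of points: the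
height of the ideal of all polynomials that vanish on `Z`. The empty set has codimension `⊤`. -/
noncomputable def codim (Z : Set (Fin N → K)) : ℕ∞ :=
  (vanishingIdeal K Z).height

/-- The codimension in affine `N`-space of the singular locus of the scheme defined by the
vanishing of the polynomials in `σ`. -/
noncomputable def codimSing (σ : Set (MvPolynomial (Fin N) K)) : ℕ∞ :=
  codim (singularLocus (Ideal.span σ))

/-- The family of all subsets of `V` that consist of nonzero forms with mutually distinct
degrees. -/
def distinctDegreeSets (V : Submodule K (MvPolynomial (Fin N) K)) :
    Set (Set (MvPolynomial (Fin N) K)) :=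
  {σ | (∀ f ∈ σ, f ∈ V ∧ f ≠ 0 ∧ ∃ e : ℕ, f.IsHomogeneous e) ∧ Set.InjOn totalDegree σ}

end SmallSubalgebras

namespace SmallSubalgebras

open MvPolynomial

variable {K : Type*} [Field K] {N : ℕ}

/-! Let P be a minimal prime over the ideal of Sing X. Where X is singular the gradients of the F_i
are dependent, so some relation ∑ c_i ∇F_i ≡ 0 mod P holds with polynomial coefficients not all in P
(`exists_gradient_relation_of_vanishingIdeal_le`). Freeze the coefficients at a general point y of
V(P), a_i = c_i(y). Requiring c to stay proportional to a costs n - 1 equations, so some component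
V(Q) through y has height at most ht P + n - 1 (`exists_notMem_forall_height_le`), and ∑ a_i F_i has
zero gradient at its general points.

Let σ be the set of nonzero homogeneous components of ∑ a_i F_i. It extends to n generators of the
ideal of X, hence V(σ) has codimension at least |σ| at points of X, while its generators satisfy a
gradient relation with all coefficients 1. Thus V(σ) is singular along V(Q)
(`not_isRegularLocalRing_of_gradient_sum_eq_zero`) and C_σ ≤ ht Q. Only first-order Taylor expansion
is used, never Euler's formula, so the characteristic plays no role. -/

/-! ### Taylor expansion and height at a closed point. -/

theorem eval_eq_zero_of_mem_vanishingIdeal_singleton {x : Fin N → K} {f : MvPolynomial (Fin N) K} :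
    f ∈ vanishingIdeal K {x} ↔ eval x f = 0 := by
  simp [aeval_eq_eval]

theorem sub_taylor_mem_sq (x : Fin N → K) (f : MvPolynomial (Fin N) K) :
    f - C (eval x f) - ∑ j, C (eval x (pderiv j f)) * (X j - C (x j)) ∈
      vanishingIdeal K {x} ^ 2 := by
  have hX : ∀ j, (X j - C (x j) : MvPolynomial (Fin N) K) ∈ vanishingIdeal K {x} := fun j => by simp
  induction f using MvPolynomial.induction_on with
  | C a => simp
  | add p q hp hq =>
    convert add_mem hp hq using 1
    simp only [map_add, add_mul, Finset.sum_add_distrib]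
    ring
  | mul_X p i hp =>
    have h1 := Ideal.mul_mem_right (X i) _ hp
    have h2 : (∑ j, C (eval x (pderiv j p)) * (X j - C (x j))) * (X i - C (x i)) ∈
        vanishingIdeal K {x} ^ 2 := by
      rw [pow_two]
      exact Ideal.mul_mem_mul (Ideal.sum_mem _ fun j _ => Ideal.mul_mem_left _ _ (hX j)) (hX i)
    convert add_mem h1 h2 using 1
    have : ∀ j, eval x (pderiv j (p * X i)) =
        eval x (pderiv j p) * x i + eval x p * (if j = i then 1 else 0) := fun j => by
      rw [Derivation.leibniz]
      by_cases h : j = i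
      · subst h; simp; ring
      · simp [pderiv_X_of_ne (Ne.symm h), h]; ring
    simp only [this, map_mul, map_add, add_mul, Finset.sum_add_distrib, eval_X]
    have e1 : ∑ j, C (eval x p) * C (if j = i then 1 else 0) * (X j - C (x j)) =
        (C (eval x p) * (X i - C (x i)) : MvPolynomial (Fin N) K) := by
      rw [Finset.sum_eq_single i] <;> simp +contextual
    have e2 : ∑ j, C (eval x (pderiv j p)) * C (x i) * (X j - C (x j)) =
        (C (x i) * ∑ j, C (eval x (pderiv j p)) * (X j - C (x j)) : MvPolynomial (Fin N) K) := by
      rw [Finset.mul_sum]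
      exact Finset.sum_congr rfl fun j _ => by ring
    rw [e1, e2]
    ring

/-- Some maximal ideal attains the Krull dimension N, and translations carry its point to any other.
-/
theorem height_vanishingIdeal_singleton [IsAlgClosed K] (x : Fin N → K) :
    (vanishingIdeal K {x}).height = N := by
  have hdim : ringKrullDim (MvPolynomial (Fin N) K) = N := by simp
  have : FiniteRingKrullDim (MvPolynomial (Fin N) K) :=
    finiteRingKrullDim_iff_ne_bot_and_top.2 ⟨by simp [hdim], by
      rw [hdim]; exact WithBot.coe_injective.ne (ENat.natCast_ne_top N)⟩
  obtain ⟨p, hp, hht⟩ := Ideal.exists_isMaximal_height (R := MvPolynomial (Fin N) K)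
  obtain ⟨y, rfl⟩ := eq_vanishingIdeal_singleton_of_isMaximal K hp
  let e : MvPolynomial (Fin N) K ≃ₐ[K] MvPolynomial (Fin N) K :=
    AlgEquiv.ofAlgHom (aeval fun j => X j + C (x j - y j)) (aeval fun j => X j - C (x j - y j))
      (by ext; simp) (by ext; simp)
  have hcomap : (vanishingIdeal K {y}).comap e.toRingEquiv = vanishingIdeal K {x} := by
    ext f
    have : (eval y).comp (e : MvPolynomial (Fin N) K →+* MvPolynomial (Fin N) K) = eval x := by
      ext j <;> simp [e]
    rw [Ideal.mem_comap, eval_eq_zero_of_mem_vanishingIdeal_singleton,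
      eval_eq_zero_of_mem_vanishingIdeal_singleton, ← this]
    rfl
  rw [← hcomap, RingEquiv.height_comap]
  rw [hdim] at hht
  exact_mod_cast hht

/-! ### Dimension bounds and matrices modulo a prime. -/

theorem supportDim_add_length_le_of_isWeaklyRegular {R : Type*} [CommRing R]
    {M : Type*} [AddCommGroup M] [Module R M] [Module.Finite R M] (rs : List R)
    (reg : RingTheory.Sequence.IsWeaklyRegular M rs) :
    Module.supportDim R (M ⧸ Ideal.ofList rs • (⊤ : Submodule R M)) + rs.length ≤
      Module.supportDim R M := by
  induction rs generalizing M with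
  | nil =>
    rw [Ideal.ofList_nil, Submodule.bot_smul]
    simpa using (Module.supportDim_eq_of_equiv (Submodule.quotEquivOfEqBot ⊥ rfl)).le
  | cons x rs' ih =>
    obtain ⟨h1, h2⟩ := (RingTheory.Sequence.isWeaklyRegular_cons_iff M _ _).mp reg
    have h3 := Module.supportDim_quotSMulTop_succ_le_of_notMem_minimalPrimes (M := M) (x := x)
      fun _ => h1.notMem_of_mem_minimalPrimes
    refine le_trans ?_ h3
    refine le_trans ?_ (add_le_add_left (ih h2) 1)
    rw [Module.supportDim_eq_of_equiv (Submodule.quotOfListConsSMulTopEquivQuotSMulTopInner M x _)]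
    simp [add_assoc]

theorem ringKrullDim_add_length_le_of_isWeaklyRegular {R : Type*} [CommRing R] (rs : List R)
    (reg : RingTheory.Sequence.IsWeaklyRegular R rs) :
    ringKrullDim (R ⧸ Ideal.ofList rs) + rs.length ≤ ringKrullDim R := by
  have eq : Ideal.ofList rs = Ideal.ofList rs • (⊤ : Ideal R) := by simp
  rw [ringKrullDim_eq_of_ringEquiv (Ideal.quotientEquivAlgOfEq R eq).toRingEquiv,
    ← Module.supportDim_quotient_eq_ringKrullDim, ← Module.supportDim_self_eq_ringKrullDim]
  exact supportDim_add_length_le_of_isWeaklyRegular rs reg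

/-- P is minimal over an ideal with ht P generators. Choosing f in all the other minimal primes but
not in P, these generators cut out V(P) wherever f ≠ 0, so Krull's height theorem applies to them
together with D. -/
theorem exists_notMem_forall_height_le {R : Type*} [CommRing R] [IsNoetherianRing R]
    (P : Ideal R) [P.IsPrime] :
    ∃ f ∉ P, ∀ (D : Finset R) (Q : Ideal R), Q ∈ (P ⊔ Ideal.span (D : Set R)).minimalPrimes →
      f ∉ Q → Q.height ≤ P.height + D.card := by
  classical
  obtain ⟨a, ha, hcard⟩ := P.exists_finset_card_eq_height_of_isNoetherianRing
  have hfin : (Ideal.span (a : Set R)).minimalPrimes.Finite :=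
    Ideal.finite_minimalPrimes_of_isNoetherianRing R _
  let T := hfin.toFinset.erase P
  have hT : ¬ T.inf id ≤ P := by
    intro h
    obtain ⟨P', hP', hle⟩ := (Ideal.IsPrime.inf_le' inferInstance).1 h
    rw [Finset.mem_erase, Set.Finite.mem_toFinset] at hP'
    exact hP'.1 (le_antisymm hle (ha.2 hP'.2.1 hle))
  obtain ⟨f, hf, hfP⟩ := SetLike.not_le_iff_exists.1 hT
  refine ⟨f, hfP, fun D Q hQ hfQ => ?_⟩
  have hQp : Q.IsPrime := hQ.1.1
  have key : Q ∈ (Ideal.span ((a ∪ D : Finset R) : Set R)).minimalPrimes := by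
    rw [Finset.coe_union, Ideal.span_union]
    refine ⟨⟨hQp, sup_le (ha.1.2.trans (le_sup_left.trans hQ.1.2)) (le_sup_right.trans hQ.1.2)⟩,
      fun Q' hQ' hle => hQ.2 ⟨hQ'.1, sup_le ?_ (le_sup_right.trans hQ'.2)⟩ hle⟩
    have := hQ'.1
    obtain ⟨P', hP', hP'Q⟩ := Ideal.exists_minimalPrimes_le (le_sup_left.trans hQ'.2)
    by_cases h : P' = P
    · exact h ▸ hP'Q
    · have : f ∈ P' := (Finset.inf_le (f := id) (b := P') (by simp [T, h, hP']) : T.inf id ≤ P') hf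
      exact absurd (hle (hP'Q this)) hfQ
  refine (Ideal.height_le_card_of_mem_minimalPrimes_span_finset key).trans ?_
  rw [← hcard]
  exact_mod_cast Finset.card_union_le _ _

theorem exists_relation_or_exists_det_notMem {R : Type*} [CommRing R] (P : Ideal R) [P.IsPrime]
    {m n : Type*} [Fintype m] [Fintype n] [DecidableEq n] (M : Matrix n m R) :
    (∃ c : n → R, (∃ i, c i ∉ P) ∧ ∀ j, ∑ i, c i * M i j ∈ P) ∨
      ∃ B : Matrix m n R, (M * B).det ∉ P := by
  classical
  let π := Ideal.Quotient.mk P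
  have hπ : Function.Surjective π := Ideal.Quotient.mk_surjective
  let Mq : n → m → R ⧸ P := M.map π
  by_cases hLI : LinearIndependent (R ⧸ P) Mq
  · right
    let L := FractionRing (R ⧸ P)
    have h1 : LinearIndependent (R ⧸ P) fun i j => algebraMap (R ⧸ P) L (Mq i j) :=
      hLI.map_injOn (((Algebra.linearMap (R ⧸ P) L).compLeft m))
        (Function.Injective.injOn fun u v huv => funext fun j =>
          IsFractionRing.injective (R ⧸ P) L (congrFun huv j))
    rw [LinearIndependent.iff_fractionRing (R ⧸ P) L] at h1
    let ML : Matrix n m L := (M.map π).map (algebraMap (R ⧸ P) L)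
    obtain ⟨BL, hBL⟩ : ∃ BL : Matrix m n L, ML * BL = 1 := by
      rw [← Matrix.mulVec_surjective_iff_exists_right_inverse]
      have hrank : ML.rank = Fintype.card n := LinearIndependent.rank_matrix h1
      rw [Matrix.rank] at hrank
      have htop : ML.mulVecLin.range = ⊤ :=
        Submodule.eq_top_of_finrank_eq (by rw [hrank, Module.finrank_fintype_fun_eq_card])
      exact LinearMap.range_eq_top.1 htop
    obtain ⟨d, hd⟩ := IsLocalization.exist_integer_multiples_of_finite (nonZeroDivisors (R ⧸ P))
      fun p : m × n => BL p.1 p.2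
    choose Bq hBq using hd
    choose B hB using fun p => hπ (Bq p)
    refine ⟨fun j i => B (j, i), fun hdet => ?_⟩
    have h2 : (M.map π) * (Matrix.of fun j i => Bq (j, i)) = (d : R ⧸ P) • 1 := by
      apply Matrix.map_injective (IsFractionRing.injective (R ⧸ P) L)
      have : (Matrix.of fun j i => Bq (j, i)).map (algebraMap (R ⧸ P) L) = (d : R ⧸ P) • BL := by
        ext j i; simp [hBq]
      beta_reduce
      rw [Matrix.map_mul, this, Matrix.mul_smul, hBL]
      ext i j
      rw [Matrix.smul_apply, Matrix.map_apply, Matrix.smul_apply, smul_eq_mul, map_mul, Algebra.smul_def]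
      by_cases h : i = j
      · subst h; simp
      · simp [h]
    have h3 : π (M * Matrix.of fun j i => B (j, i)).det = (d : R ⧸ P) ^ Fintype.card n := by
      rw [RingHom.map_det, RingHom.mapMatrix_apply, Matrix.map_mul]
      have : (Matrix.of fun j i => B (j, i)).map π = Matrix.of fun j i => Bq (j, i) := by
        ext; simp [hB]
      rw [this, h2]
      simp
    have h4 : π (M * Matrix.of fun j i => B (j, i)).det = 0 := Ideal.Quotient.eq_zero_iff_mem.2 hdet
    rw [h3] at h4
    exact pow_ne_zero _ (nonZeroDivisors.ne_zero d.2) h4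
  · left
    rw [Fintype.linearIndependent_iff] at hLI
    push Not at hLI
    obtain ⟨g, hg, i, hi⟩ := hLI
    choose c hc using fun i => hπ (g i)
    refine ⟨c, ⟨i, fun h => hi ?_⟩, fun j => ?_⟩
    · rw [← hc]; exact Ideal.Quotient.eq_zero_iff_mem.2 h
    · rw [← Ideal.Quotient.eq_zero_iff_mem]
      have := congrFun hg j
      simpa [hc, Mq, π] using this

/-! ### Gradients and regularity of local rings. -/

theorem le_vanishingIdeal_singleton {I : Ideal (MvPolynomial (Fin N) K)} {x : Fin N → K}
    (hx : x ∈ zeroLocus K I) : I ≤ vanishingIdeal K {x} := fun f hf =>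
  (mem_vanishingIdeal_singleton_iff x f).2 (hx f hf)

theorem mk_mem_pointIdeal_iff {I : Ideal (MvPolynomial (Fin N) K)} {x : Fin N → K}
    (hx : x ∈ zeroLocus K I) {f : MvPolynomial (Fin N) K} :
    Ideal.Quotient.mk I f ∈ pointIdeal I x hx ↔ f ∈ vanishingIdeal K {x} := by
  rw [mem_vanishingIdeal_singleton_iff]; rfl

theorem pointIdeal_eq_map {I : Ideal (MvPolynomial (Fin N) K)} {x : Fin N → K}
    (hx : x ∈ zeroLocus K I) :
    pointIdeal I x hx = (vanishingIdeal K {x}).map (Ideal.Quotient.mk I) := by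
  ext g
  obtain ⟨f, rfl⟩ := Ideal.Quotient.mk_surjective g
  rw [mk_mem_pointIdeal_iff, Ideal.mem_map_iff_of_surjective _ Ideal.Quotient.mk_surjective]
  refine ⟨fun h => ⟨f, h, rfl⟩, ?_⟩
  rintro ⟨f', hf', h⟩
  exact (mk_mem_pointIdeal_iff hx).1 (h ▸ (mk_mem_pointIdeal_iff hx).2 hf')

instance (I : Ideal (MvPolynomial (Fin N) K)) (x : Fin N → K) (hx : x ∈ zeroLocus K I) :
    IsNoetherianRing (localRingAt I x hx) :=
  IsLocalization.isNoetherianRing (pointIdeal I x hx).primeCompl _ inferInstance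

/-- The gradient of a polynomial at a point. -/
noncomputable def gradient (x : Fin N → K) : MvPolynomial (Fin N) K →ₗ[K] (Fin N → K) :=
  LinearMap.pi fun j => (aeval x).toLinearMap ∘ₗ (pderiv j).toLinearMap

theorem gradient_apply (x : Fin N → K) (f : MvPolynomial (Fin N) K) (j : Fin N) :
    gradient x f j = eval x (pderiv j f) := by
  simp [gradient, aeval_eq_eval]

/-- The linear form in the coordinates centred at `x` with the given coefficients. -/
noncomputable def linearFormAt (x : Fin N → K) : (Fin N → K) →ₗ[K] MvPolynomial (Fin N) K :=
  Fintype.linearCombination K fun j => X j - C (x j)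

theorem linearFormAt_apply (x : Fin N → K) (w : Fin N → K) :
    linearFormAt x w = ∑ j, C (w j) * (X j - C (x j)) := by
  simp [linearFormAt, Fintype.linearCombination_apply, smul_eq_C_mul]

theorem linearFormAt_mem (x : Fin N → K) (w : Fin N → K) :
    linearFormAt x w ∈ vanishingIdeal K {x} := by
  rw [linearFormAt_apply]
  exact Ideal.sum_mem _ fun j _ => Ideal.mul_mem_left _ _ (by simp)

theorem sub_linearFormAt_gradient_mem_sq {x : Fin N → K} {f : MvPolynomial (Fin N) K}
    (hf : f ∈ vanishingIdeal K {x}) :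
    f - linearFormAt x (gradient x f) ∈ vanishingIdeal K {x} ^ 2 := by
  have h := sub_taylor_mem_sq x f
  rw [eval_eq_zero_of_mem_vanishingIdeal_singleton.1 hf] at h
  simpa [linearFormAt_apply, gradient_apply] using h

theorem maximalIdeal_le_of_le_sup_mul_self {A : Type*} [CommRing A] [IsLocalRing A]
    [IsNoetherianRing A] {I : Ideal A} (h : IsLocalRing.maximalIdeal A ≤
      I ⊔ IsLocalRing.maximalIdeal A * IsLocalRing.maximalIdeal A) :
    IsLocalRing.maximalIdeal A ≤ I :=
  Submodule.le_of_le_smul_of_le_jacobson_bot (IsNoetherian.noetherian _)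
    (IsLocalRing.maximalIdeal_le_jacobson _) h

/-- Linear forms from a complement of the span of the gradients generate the maximal ideal by
Nakayama. There are N - n of them, and n equations lower the height N by at most n. -/
theorem isRegularLocalRing_of_linearIndependent_gradient [IsAlgClosed K] {n : ℕ}
    (F : Fin n → MvPolynomial (Fin N) K) {I : Ideal (MvPolynomial (Fin N) K)}
    (hI : I = Ideal.span (Set.range F)) (x : Fin N → K) (hx : x ∈ zeroLocus K I)
    (hLI : LinearIndependent K fun i => gradient x (F i)) :
    IsRegularLocalRing (localRingAt I x hx) := by
  classical
  have hFI : ∀ i, F i ∈ I := fun i => hI ▸ Ideal.subset_span ⟨i, rfl⟩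
  have hF : ∀ i, F i ∈ vanishingIdeal K {x} := fun i => le_vanishingIdeal_singleton hx (hFI i)
  let W := Submodule.span K (Set.range fun i => gradient x (F i))
  obtain ⟨U, hU⟩ := exists_isCompl W
  have hW : Module.finrank K W = n := by simpa using finrank_span_eq_card hLI
  have hWU := Submodule.finrank_add_eq_of_isCompl hU
  rw [hW, Module.finrank_fin_fun] at hWU
  let u := Module.finBasis K U
  let l : Fin (Module.finrank K U) → MvPolynomial (Fin N) K := fun k => linearFormAt x (u k)
  let J : Ideal (MvPolynomial (Fin N) K) :=
    I ⊔ Ideal.span (Set.range l) ⊔ vanishingIdeal K {x} ^ 2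
  have hJ : ∀ w, linearFormAt x w ∈ J := by
    have hle : (W ⊔ U) ≤ (J.restrictScalars K).comap (linearFormAt x) := by
      refine sup_le (Submodule.span_le.2 ?_) ?_
      · rintro _ ⟨i, rfl⟩
        have h1 : F i ∈ J := Ideal.mem_sup_left (Ideal.mem_sup_left (hFI i))
        have h2 := Ideal.mem_sup_right (S := I ⊔ Ideal.span (Set.range l))
          (sub_linearFormAt_gradient_mem_sq (hF i))
        simpa using J.sub_mem h1 h2
      · intro w hw
        have := u.sum_repr ⟨w, hw⟩
        rw [Subtype.ext_iff] at this
        rw [← show _ = w from this, Submodule.coe_sum]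
        refine Submodule.sum_mem _ fun k _ => Submodule.smul_mem _ _ ?_
        exact Ideal.mem_sup_left (Ideal.mem_sup_right (Ideal.subset_span ⟨k, rfl⟩))
    rw [hU.sup_eq_top] at hle
    exact fun w => hle (Submodule.mem_top (x := w))
  have hmJ : vanishingIdeal K {x} ≤ J := fun g hg => by
    simpa using J.add_mem (Ideal.mem_sup_right (sub_linearFormAt_gradient_mem_sq hg))
      (hJ (gradient x g))
  let A := localRingAt I x hx
  let φ : MvPolynomial (Fin N) K →+* A :=
    (algebraMap (MvPolynomial (Fin N) K ⧸ I) A).comp (Ideal.Quotient.mk I)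
  have hmA : IsLocalRing.maximalIdeal A = (vanishingIdeal K {x}).map φ := by
    rw [← Ideal.map_map, ← pointIdeal_eq_map hx, Localization.AtPrime.map_eq_maximalIdeal]
  have hIA : I.map φ = ⊥ := by
    rw [← Ideal.map_map, Ideal.map_quotient_self, Ideal.map_bot]
  have hspan : IsLocalRing.maximalIdeal A = Ideal.span (φ '' Set.range l) := by
    apply le_antisymm
    · refine maximalIdeal_le_of_le_sup_mul_self (A := A) ?_
      have := Ideal.map_mono (f := φ) hmJ
      rw [Ideal.map_sup, Ideal.map_sup, hIA, bot_sup_eq, Ideal.map_span, Ideal.map_pow,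
        ← hmA, pow_two] at this
      exact this
    · rw [Ideal.span_le]
      rintro _ ⟨_, ⟨k, rfl⟩, rfl⟩
      rw [hmA]
      exact Ideal.mem_map_of_mem _ (linearFormAt_mem x _)
  apply IsRegularLocalRing.of_spanFinrank_maximalIdeal_le
  have h1 : (IsLocalRing.maximalIdeal A).spanFinrank ≤ Module.finrank K U := by
    rw [hspan]
    refine (Submodule.spanFinrank_span_le_ncard_of_finite ((Set.finite_range l).image φ)).trans ?_
    rw [← Set.range_comp]
    rw [← Set.image_univ]
    exact (Set.ncard_image_le Set.finite_univ).trans (by simp)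
  have h2 : (vanishingIdeal K {x}).height ≤ (pointIdeal I x hx).height + n := by
    have := Ideal.height_le_height_add_spanFinrank_of_le (le_vanishingIdeal_singleton hx)
    rw [← pointIdeal_eq_map hx] at this
    refine this.trans (add_le_add_right (Nat.cast_le.2 ?_) _)
    rw [hI]
    refine (Submodule.spanFinrank_span_le_ncard_of_finite (Set.finite_range F)).trans ?_
    rw [← Set.image_univ]
    exact (Set.ncard_image_le Set.finite_univ).trans (by simp)
  rw [height_vanishingIdeal_singleton, show (N : ℕ∞) = Module.finrank K U + n by
    rw [add_comm]; exact_mod_cast hWU.symm] at h2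
  rw [IsLocalization.AtPrime.ringKrullDim_eq_height (pointIdeal I x hx)]
  have h3 := (ENat.add_le_add_iff_right (ENat.natCast_ne_top n)).1 h2
  exact_mod_cast (Nat.cast_le (α := ℕ∞).2 h1).trans h3

/-- If the local ring were regular of dimension h, lifts of h parameters and the G d would generate
the maximal ideal of the ambient local ring. Modulo its square one G d is redundant, so N ≤ h + |E|
- 1. -/
theorem not_isRegularLocalRing_of_gradient_sum_eq_zero [IsAlgClosed K] {ι : Type*}
    (E : Finset ι) (G : ι → MvPolynomial (Fin N) K) {I : Ideal (MvPolynomial (Fin N) K)}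
    (hGI : I = Ideal.span (G '' E)) (x : Fin N → K) (hx : x ∈ zeroLocus K I) (hE : E.Nonempty)
    (hgrad : gradient x (∑ d ∈ E, G d) = 0) (hht : (pointIdeal I x hx).height + E.card ≤ N) :
    ¬ IsRegularLocalRing (localRingAt I x hx) := by
  classical
  intro hreg
  obtain ⟨d₀, hd₀⟩ := hE
  have hG : ∀ d ∈ E, G d ∈ vanishingIdeal K {x} := fun d hd =>
    le_vanishingIdeal_singleton hx (hGI ▸ Ideal.subset_span ⟨d, hd, rfl⟩)
  have hsum : ∑ d ∈ E, G d ∈ vanishingIdeal K {x} ^ 2 := by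
    simpa [hgrad] using sub_linearFormAt_gradient_mem_sq (Ideal.sum_mem _ hG)
  let A := localRingAt I x hx
  obtain ⟨s, hscard, hs⟩ := Submodule.FG.exists_span_finset_card_eq_spanFinrank
    (IsNoetherian.noetherian (IsLocalRing.maximalIdeal A))
  -- Up to a unit, every element of the local ring comes from a polynomial.
  have hrep : ∀ a : A, ∃ f : MvPolynomial (Fin N) K,
      Associated a (algebraMap _ A (Ideal.Quotient.mk I f)) := fun a => by
    obtain ⟨⟨g, w⟩, h⟩ := IsLocalization.surj (pointIdeal I x hx).primeCompl a
    obtain ⟨f, rfl⟩ := Ideal.Quotient.mk_surjective g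
    obtain ⟨v, hv⟩ := IsLocalization.map_units A w
    exact ⟨f, v, by rw [hv]; exact h⟩
  choose t ht using hrep
  have htmem : ∀ a ∈ s, t a ∈ vanishingIdeal K {x} := fun a ha => by
    rw [← mk_mem_pointIdeal_iff hx,
      ← IsLocalization.AtPrime.to_map_mem_maximal_iff A (pointIdeal I x hx)]
    obtain ⟨v, hv⟩ := ht a
    rw [← hv]
    refine Ideal.mul_mem_right _ _ ?_
    rw [← hs]
    exact Submodule.subset_span ha
  let T := s.image t
  have hle : IsLocalRing.maximalIdeal A ≤
      ((Ideal.span (T : Set (MvPolynomial (Fin N) K))).map (Ideal.Quotient.mk I)).map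
        (algebraMap _ A) := by
    rw [← hs]
    refine Submodule.span_le.2 fun a ha => ?_
    have h := Ideal.mem_map_of_mem (algebraMap _ A) (Ideal.mem_map_of_mem (Ideal.Quotient.mk I)
      (Ideal.subset_span (show t a ∈ (T : Set (MvPolynomial (Fin N) K)) from
        Finset.mem_coe.2 (Finset.mem_image_of_mem t ha))))
    obtain ⟨v, hv⟩ := (ht a).symm
    rw [SetLike.mem_coe, ← hv]
    exact Ideal.mul_mem_right _ _ h
  let B := Localization.AtPrime (vanishingIdeal K {x})
  let ψ := algebraMap (MvPolynomial (Fin N) K) B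
  have hmB : IsLocalRing.maximalIdeal B = (vanishingIdeal K {x}).map ψ :=
    Localization.AtPrime.map_eq_maximalIdeal.symm
  -- `G d₀` is omitted: modulo the square it is minus the sum of the others.
  let S : Finset (MvPolynomial (Fin N) K) := T ∪ (E.erase d₀).image G
  have hIS : Ideal.span (T : Set (MvPolynomial (Fin N) K)) ⊔ I ≤
      Ideal.span (S : Set (MvPolynomial (Fin N) K)) ⊔ vanishingIdeal K {x} ^ 2 := by
    have hS : ∀ d ∈ E.erase d₀, G d ∈ Ideal.span (S : Set (MvPolynomial (Fin N) K)) :=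
      fun d hd => Ideal.subset_span (Finset.mem_coe.2
        (Finset.mem_union_right _ (Finset.mem_image_of_mem G hd)))
    refine sup_le ((Ideal.span_mono (Finset.coe_subset.2 Finset.subset_union_left)).trans
      le_sup_left) ?_
    rw [hGI, Ideal.span_le]
    rintro _ ⟨d, hd, rfl⟩
    by_cases h : d = d₀
    · subst h
      rw [← Finset.add_sum_erase E G hd] at hsum
      have h1 := Ideal.mem_sup_left (T := vanishingIdeal K {x} ^ 2) (Ideal.sum_mem _ hS)
      have h2 := Ideal.mem_sup_right (S := Ideal.span (S : Set (MvPolynomial (Fin N) K))) hsum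
      simpa using Ideal.sub_mem _ h2 h1
    · exact Ideal.mem_sup_left (hS d (Finset.mem_erase.2 ⟨h, hd⟩))
  have hspan : IsLocalRing.maximalIdeal B = Ideal.span (ψ '' S) := by
    apply le_antisymm
    · refine maximalIdeal_le_of_le_sup_mul_self ?_
      have h1 := Ideal.map_mono (f := ψ) hIS
      rw [Ideal.map_sup (I := Ideal.span (S : Set (MvPolynomial (Fin N) K))), Ideal.map_pow,
        ← hmB, pow_two, Ideal.map_span (s := (S : Set (MvPolynomial (Fin N) K)))] at h1
      refine le_trans ?_ h1
      rw [hmB, Ideal.map_le_iff_le_comap]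
      intro g hg
      have h2 : algebraMap _ A (Ideal.Quotient.mk I g) ∈ IsLocalRing.maximalIdeal A := by
        rwa [IsLocalization.AtPrime.to_map_mem_maximal_iff A (pointIdeal I x hx),
          mk_mem_pointIdeal_iff]
      obtain ⟨w, hw, hwg⟩ := (IsLocalization.algebraMap_mem_map_algebraMap_iff
        (pointIdeal I x hx).primeCompl A _ _).1 (hle h2)
      obtain ⟨w, rfl⟩ := Ideal.Quotient.mk_surjective w
      rw [← map_mul, Ideal.mem_map_iff_of_surjective _ Ideal.Quotient.mk_surjective] at hwg
      obtain ⟨b, hb, hbw⟩ := hwg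
      rw [Ideal.mem_comap, IsLocalization.algebraMap_mem_map_algebraMap_iff
        (vanishingIdeal K {x}).primeCompl B]
      refine ⟨w, fun h => hw ((mk_mem_pointIdeal_iff hx).2 h), ?_⟩
      have h3 := Ideal.sub_mem _ (Ideal.mem_sup_left (T := I) hb)
        (Ideal.mem_sup_right (S := Ideal.span (T : Set (MvPolynomial (Fin N) K)))
          (Ideal.Quotient.eq.1 hbw))
      simpa using h3
    · rw [Ideal.span_le]
      rintro _ ⟨f, hf, rfl⟩
      rw [hmB]
      refine Ideal.mem_map_of_mem _ ?_
      rcases Finset.mem_union.1 (Finset.mem_coe.1 hf) with hf | hf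
      · obtain ⟨a, ha, rfl⟩ := Finset.mem_image.1 hf
        exact htmem a ha
      · obtain ⟨d, hd, rfl⟩ := Finset.mem_image.1 hf
        exact hG d (Finset.mem_of_mem_erase hd)
  have hB : (N : WithBot ℕ∞) ≤ S.card := by
    have h1 := ringKrullDim_le_spanFinrank_maximalIdeal B
    rw [IsLocalization.AtPrime.ringKrullDim_eq_height (vanishingIdeal K {x}),
      height_vanishingIdeal_singleton] at h1
    refine le_trans (by exact_mod_cast h1) (?_ :
      ((IsLocalRing.maximalIdeal B).spanFinrank : WithBot ℕ∞) ≤ _)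
    have h2 : (IsLocalRing.maximalIdeal B).spanFinrank ≤ S.card := by
      rw [hspan]
      refine (Submodule.spanFinrank_span_le_ncard_of_finite (S.finite_toSet.image ψ)).trans ?_
      simpa using Set.ncard_image_le (f := ψ) S.finite_toSet
    exact_mod_cast h2
  have hS : S.card + 1 ≤ s.card + E.card := by
    have h1 := Finset.card_union_le T ((E.erase d₀).image G)
    have h2 : T.card ≤ s.card := Finset.card_image_le
    have h3 : ((E.erase d₀).image G).card ≤ _ := Finset.card_image_le
    have h4 := Finset.card_erase_add_one hd₀
    have : S.card ≤ _ := h1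
    omega
  have hA := hreg.spanFinrank_maximalIdeal
  rw [IsLocalization.AtPrime.ringKrullDim_eq_height (pointIdeal I x hx), ← hscard] at hA
  have hA' : (s.card : ℕ∞) = (pointIdeal I x hx).height := by exact_mod_cast hA
  rw [← hA'] at hht
  have : s.card + E.card ≤ N := by exact_mod_cast hht
  have : N ≤ S.card := by exact_mod_cast hB
  omega

/-! ### From the singular locus of X to sets of forms of distinct degrees. -/

/-- Passing from I to J adds |D| equations, so the height is at most dim R/J + |D| ≤ N - n + |D|. -/
theorem height_pointIdeal_add_card_le {n : ℕ} {I J : Ideal (MvPolynomial (Fin N) K)}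
    (hJ : ringKrullDim (MvPolynomial (Fin N) K ⧸ J) + n ≤ N)
    (D : Finset (MvPolynomial (Fin N) K)) (hD : J = I ⊔ Ideal.span D) {s : ℕ}
    (hs : D.card + s ≤ n) (x : Fin N → K) (hx : x ∈ zeroLocus K I) (hxJ : x ∈ zeroLocus K J) :
    (pointIdeal I x hx).height + s ≤ N := by
  classical
  have hIJ : I ≤ J := hD ▸ le_sup_left
  have hle : J.map (Ideal.Quotient.mk I) ≤ pointIdeal I x hx := by
    rw [pointIdeal_eq_map]
    exact Ideal.map_mono (le_vanishingIdeal_singleton hxJ)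
  have h1 := height_le_ringKrullDim_quotient_add_spanFinrank hle
  rw [ringKrullDim_eq_of_ringEquiv (DoubleQuot.quotQuotEquivQuotOfLE hIJ)] at h1
  have h2 : (J.map (Ideal.Quotient.mk I)).spanFinrank ≤ D.card := by
    rw [hD, Ideal.map_sup, Ideal.map_quotient_self, bot_sup_eq, Ideal.map_span]
    refine (Submodule.spanFinrank_span_le_ncard_of_finite (D.finite_toSet.image _)).trans ?_
    simpa using Set.ncard_image_le (f := Ideal.Quotient.mk I) D.finite_toSet
  have h3 : ((pointIdeal I x hx).height : WithBot ℕ∞) + s ≤ N := calc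
    _ ≤ ringKrullDim (MvPolynomial (Fin N) K ⧸ J) + D.card + s := by
        gcongr
        refine h1.trans ?_
        gcongr
    _ ≤ ringKrullDim (MvPolynomial (Fin N) K ⧸ J) + n := by
        rw [add_assoc]
        gcongr
        exact_mod_cast hs
    _ ≤ N := hJ
  exact_mod_cast h3

/-- A finite family of polynomials has dependent gradients along the closure of the singular locus
of its zero scheme. -/
theorem exists_gradient_relation_of_vanishingIdeal_le [IsAlgClosed K] {n : ℕ}
    (F : Fin n → MvPolynomial (Fin N) K) (P : Ideal (MvPolynomial (Fin N) K)) [P.IsPrime]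
    (hP : vanishingIdeal K (singularLocus (Ideal.span (Set.range F))) ≤ P) :
    ∃ c : Fin n → MvPolynomial (Fin N) K, (∃ i, c i ∉ P) ∧
      ∀ j, ∑ i, c i * pderiv j (F i) ∈ P := by
  classical
  let M : Matrix (Fin n) (Fin N) (MvPolynomial (Fin N) K) := Matrix.of fun i j => pderiv j (F i)
  refine (exists_relation_or_exists_det_notMem P M).resolve_right ?_
  rintro ⟨B, hB⟩
  refine hB (hP ?_)
  rintro x ⟨hx, hsing⟩
  have hdep : ¬ LinearIndependent K fun i => gradient x (F i) := fun h =>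
    hsing (isRegularLocalRing_of_linearIndependent_gradient F rfl x hx h)
  rw [Fintype.linearIndependent_iff] at hdep
  push Not at hdep
  -- A dependency at x is a left kernel vector of the evaluated Jacobian, hence of its product with
  -- B.
  obtain ⟨a, ha, i, hi⟩ := hdep
  rw [aeval_eq_eval, RingHom.map_det, RingHom.mapMatrix_apply, Matrix.map_mul]
  refine Matrix.exists_vecMul_eq_zero_iff.1 ⟨a, fun h => hi (congrFun h i), ?_⟩
  rw [← Matrix.vecMul_vecMul]
  have : Matrix.vecMul a (M.map (eval x)) = 0 := by
    rw [← ha]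
    ext j
    simp [Matrix.vecMul, dotProduct, M, gradient_apply]
  rw [this, Matrix.zero_vecMul]

/-- If a fixed linear combination of a homogeneous basis has zero gradient at the general point of
an irreducible closed subset of its zero set, then the set of the nonzero homogeneous components of
that combination defines a scheme that is singular along this subset. -/
theorem codimSing_le_height_of_relation [IsAlgClosed K] {n : ℕ}
    {V : Submodule K (MvPolynomial (Fin N) K)} (F : Module.Basis (Fin n) K V)
    (hF : ∀ i, ∃ e : ℕ, (F i : MvPolynomial (Fin N) K).IsHomogeneous e)
    (hdim : ringKrullDim (MvPolynomial (Fin N) K ⧸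
      Ideal.span (Set.range fun i => (F i : MvPolynomial (Fin N) K))) + n ≤ N)
    (a : Fin n → K) (ha : a ≠ 0) (Q : Ideal (MvPolynomial (Fin N) K)) [Q.IsPrime]
    (hFQ : ∀ i, (F i : MvPolynomial (Fin N) K) ∈ Q) (b : MvPolynomial (Fin N) K) (hb : b ∉ Q)
    (hgrad : ∀ z ∈ zeroLocus K Q, eval z b ≠ 0 →
      gradient z (∑ i, a i • (F i : MvPolynomial (Fin N) K)) = 0) :
    ∃ σ ∈ distinctDegreeSets V, codimSing σ ≤ Q.height := by
  classical
  choose e he using hF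
  let G : ℕ → MvPolynomial (Fin N) K := fun d =>
    ∑ i with e i = d, a i • (F i : MvPolynomial (Fin N) K)
  let E : Finset ℕ := (Finset.univ.filter fun i => a i ≠ 0).image e
  have hGV : ∀ d, G d ∈ V := fun d => V.sum_mem fun i _ => V.smul_mem _ (F i).2
  have hGhom : ∀ d, (G d).IsHomogeneous d := fun d =>
    IsHomogeneous.sum _ _ _ fun i hi => by
      rw [← (Finset.mem_filter.1 hi).2, smul_eq_C_mul]
      simpa using (isHomogeneous_C _ (a i)).mul (he i)
  have hG0 : ∀ d ∈ E, G d ≠ 0 := by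
    intro d hd h0
    obtain ⟨i, hi, rfl⟩ := Finset.mem_image.1 hd
    have h1 : ∑ k with e k = e i, a k • F k = 0 := by
      rw [← Submodule.coe_eq_zero]
      simpa [G] using h0
    exact (Finset.mem_filter.1 hi).2
      (linearIndependent_iff'.1 F.linearIndependent _ a h1 i (by simp))
  have hsum : ∑ d ∈ E, G d = ∑ i, a i • (F i : MvPolynomial (Fin N) K) := by
    have h1 : ∑ d ∈ E, G d = ∑ d ∈ Finset.univ.image e, G d := by
      refine Finset.sum_subset (Finset.image_subset_image (Finset.filter_subset _ _)) ?_
      intro d _ hd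
      refine Finset.sum_eq_zero fun i hi => ?_
      by_contra h
      refine hd (Finset.mem_image.2 ⟨i, ?_, (Finset.mem_filter.1 hi).2⟩)
      exact Finset.mem_filter.2 ⟨Finset.mem_univ _, fun h0 => h (by rw [h0, zero_smul])⟩
    rw [h1]
    exact Finset.sum_fiberwise_of_maps_to (fun i _ => Finset.mem_image_of_mem e (Finset.mem_univ i)) _
  have hEne : E.Nonempty := by
    obtain ⟨i, hi⟩ := Function.ne_iff.1 ha
    exact ⟨e i, Finset.mem_image_of_mem e (by simpa using hi)⟩
  refine ⟨G '' E, ⟨?_, ?_⟩, ?_⟩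
  · rintro _ ⟨d, hd, rfl⟩
    exact ⟨hGV d, hG0 d hd, d, hGhom d⟩
  · rintro _ ⟨d, hd, rfl⟩ _ ⟨d', hd', rfl⟩ h
    rw [(hGhom d).totalDegree (hG0 d hd), (hGhom d').totalDegree (hG0 d' hd')] at h
    rw [h]
  set I := Ideal.span (G '' E) with hI
  set J := Ideal.span (Set.range fun i => (F i : MvPolynomial (Fin N) K)) with hJ
  have hsection : ∀ d ∈ E, ∃ i, a i ≠ 0 ∧ e i = d := fun d hd => by simpa [E] using hd
  have : Nonempty (Fin n) := (Function.ne_iff.1 ha).nonempty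
  choose! r hra hre using hsection
  -- In each degree d of E, `G d` replaces the basis element `F (r d)`, whose coefficient is
  -- nonzero; D consists of the basis elements not replaced.
  let D : Finset (MvPolynomial (Fin N) K) :=
    (Finset.univ \ E.image r).image fun i => (F i : MvPolynomial (Fin N) K)
  have hDcard : D.card + E.card ≤ n := by
    have h1 : D.card ≤ (Finset.univ \ E.image r).card := Finset.card_image_le
    have h2 : (E.image r).card = E.card := Finset.card_image_of_injOn fun d hd d' hd' h => by
      rw [← hre d hd, h, hre d' hd']
    have h3 := Finset.card_sdiff_add_card_eq_card (Finset.subset_univ (E.image r))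
    rw [Finset.card_univ, Fintype.card_fin] at h3
    omega
  have hFJ : ∀ i, (F i : MvPolynomial (Fin N) K) ∈ J := fun i => Ideal.subset_span ⟨i, rfl⟩
  have hGJ : ∀ d, G d ∈ J := fun d => Ideal.sum_mem _ fun i _ => by
    rw [smul_eq_C_mul]; exact J.mul_mem_left _ (hFJ i)
  have hD : J = I ⊔ Ideal.span D := by
    apply le_antisymm
    · have hout : ∀ i, i ∉ E.image r → (F i : MvPolynomial (Fin N) K) ∈ I ⊔ Ideal.span D :=
        fun i hi => Ideal.mem_sup_right (Ideal.subset_span (Finset.mem_coe.2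
          (Finset.mem_image_of_mem _ (by simpa using hi))))
      rw [hJ, Ideal.span_le]
      rintro _ ⟨i, rfl⟩
      by_cases hi : i ∈ E.image r
      · obtain ⟨d, hd, rfl⟩ := Finset.mem_image.1 hi
        have h1 : G d ∈ I ⊔ Ideal.span D := Ideal.mem_sup_left (Ideal.subset_span ⟨d, hd, rfl⟩)
        have h2 : G d = a (r d) • (F (r d) : MvPolynomial (Fin N) K) +
            ∑ i ∈ (Finset.univ.filter fun i => e i = d).erase (r d),
              a i • (F i : MvPolynomial (Fin N) K) :=
          (Finset.add_sum_erase _ _ (by simp [hre d hd])).symm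
        have h3 : ∑ i ∈ (Finset.univ.filter fun i => e i = d).erase (r d),
            a i • (F i : MvPolynomial (Fin N) K) ∈ I ⊔ Ideal.span D := by
          refine Ideal.sum_mem _ fun i hi => ?_
          rw [smul_eq_C_mul]
          refine Ideal.mul_mem_left _ _ (hout i fun hir => ?_)
          obtain ⟨d', hd', rfl⟩ := Finset.mem_image.1 hir
          rw [Finset.mem_erase, Finset.mem_filter, hre d' hd'] at hi
          exact hi.1 (by rw [hi.2.2])
        have h4 : a (r d) • (F (r d) : MvPolynomial (Fin N) K) ∈ I ⊔ Ideal.span D := by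
          rw [h2] at h1
          exact (Ideal.add_mem_iff_left _ h3).1 h1
        have h5 := Ideal.mul_mem_left _ (C (a (r d))⁻¹) h4
        rwa [smul_eq_C_mul, ← mul_assoc, ← C_mul, inv_mul_cancel₀ (hra d hd), C_1, one_mul] at h5
      · exact hout i hi
    · refine sup_le (Ideal.span_le.2 ?_) (Ideal.span_le.2 ?_)
      · rintro _ ⟨d, _, rfl⟩
        exact hGJ d
      · intro f hf
        obtain ⟨i, _, rfl⟩ := Finset.mem_image.1 (Finset.mem_coe.1 hf)
        exact hFJ i
  have hJQ : J ≤ Q := Ideal.span_le.2 (by rintro _ ⟨i, rfl⟩; exact hFQ i)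
  have hIJ : I ≤ J := hD ▸ le_sup_left
  -- Since b is not in Q, the Nullstellensatz reduces membership of g in Q to vanishing of g at the
  -- points of V(Q) where b ≠ 0.
  refine Ideal.height_mono fun g hg => ?_
  refine ((inferInstance : Q.IsPrime).mem_or_mem (?_ : g * b ∈ Q)).resolve_right hb
  rw [← IsPrime.vanishingIdeal_zeroLocus (K := K) Q]
  intro z hz
  rw [map_mul]
  by_cases hbz : eval z b = 0
  · rw [aeval_eq_eval, hbz, mul_zero]
  have hzJ : z ∈ zeroLocus K J := zeroLocus_anti_mono hJQ hz
  have hzI : z ∈ zeroLocus K I := zeroLocus_anti_mono hIJ hzJ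
  rw [hg z ⟨hzI, not_isRegularLocalRing_of_gradient_sum_eq_zero E G hI z hzI hEne
    (by rw [hsum]; exact hgrad z hz hbz)
    (height_pointIdeal_add_card_le hdim D hD hDcard z hzI hzJ)⟩, zero_mul]

/-- The varying coefficients of the relation modulo P are made constant up to a common factor by
restricting to a smaller subvariety V(Q). -/
theorem exists_codimSing_le_height_add [IsAlgClosed K] {n : ℕ}
    {V : Submodule K (MvPolynomial (Fin N) K)} (F : Module.Basis (Fin n) K V)
    (hF : ∀ i, ∃ e : ℕ, (F i : MvPolynomial (Fin N) K).IsHomogeneous e)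
    (hdim : ringKrullDim (MvPolynomial (Fin N) K ⧸
      Ideal.span (Set.range fun i => (F i : MvPolynomial (Fin N) K))) + n ≤ N)
    (P : Ideal (MvPolynomial (Fin N) K)) [P.IsPrime]
    (hP : vanishingIdeal K (singularLocus
      (Ideal.span (Set.range fun i => (F i : MvPolynomial (Fin N) K)))) ≤ P) :
    ∃ σ ∈ distinctDegreeSets V, codimSing σ ≤ P.height + (n - 1 : ℕ) := by
  classical
  have hFP : ∀ i, (F i : MvPolynomial (Fin N) K) ∈ P := fun i =>
    hP fun x hx => hx.1 _ (Ideal.subset_span ⟨i, rfl⟩)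
  obtain ⟨c, ⟨i₀, hi₀⟩, hc⟩ :=
    exists_gradient_relation_of_vanishingIdeal_le (fun i => (F i : MvPolynomial (Fin N) K)) P hP
  obtain ⟨f, hfP, hf⟩ := exists_notMem_forall_height_le P
  obtain ⟨y, hyP, hy⟩ : ∃ y ∈ zeroLocus K P, eval y (f * c i₀) ≠ 0 := by
    by_contra! h
    have h1 : f * c i₀ ∈ vanishingIdeal K (zeroLocus K P) := fun y hy => by
      rw [aeval_eq_eval]; exact h y hy
    rw [IsPrime.vanishingIdeal_zeroLocus] at h1
    exact ((inferInstance : P.IsPrime).mem_or_mem h1).elim hfP hi₀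
  rw [map_mul, mul_ne_zero_iff] at hy
  obtain ⟨hyf, hyc⟩ := hy
  let a : Fin n → K := fun i => eval y (c i)
  -- These equations express proportionality of c to a; the one for `i₀` is trivial, whence n - 1.
  let D : Finset (MvPolynomial (Fin N) K) :=
    (Finset.univ.erase i₀).image fun i => C (a i₀) * c i - C (a i) * c i₀
  have hDcard : D.card ≤ n - 1 := by
    refine Finset.card_image_le.trans ?_
    rw [Finset.card_erase_of_mem (Finset.mem_univ _), Finset.card_univ, Fintype.card_fin]
  have hle : P ⊔ Ideal.span (D : Set (MvPolynomial (Fin N) K)) ≤ vanishingIdeal K {y} := by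
    refine sup_le (le_vanishingIdeal_singleton hyP) (Ideal.span_le.2 fun g hg => ?_)
    obtain ⟨i, _, rfl⟩ := Finset.mem_image.1 (Finset.mem_coe.1 hg)
    rw [SetLike.mem_coe, eval_eq_zero_of_mem_vanishingIdeal_singleton]
    simp [a, mul_comm]
  obtain ⟨Q, hQ, hQy⟩ := Ideal.exists_minimalPrimes_le hle
  have hQp : Q.IsPrime := hQ.1.1
  have hnotMem : ∀ g, eval y g ≠ 0 → g ∉ Q := fun g hg h =>
    hg (eval_eq_zero_of_mem_vanishingIdeal_singleton.1 (hQy h))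
  have hPQ : P ≤ Q := le_sup_left.trans hQ.1.2
  have hrel : ∀ i, C (a i₀) * c i - C (a i) * c i₀ ∈ Q := fun i => by
    by_cases h : i = i₀
    · subst h; simp
    · exact hQ.1.2 (Ideal.mem_sup_right (Ideal.subset_span (Finset.mem_coe.2
        (Finset.mem_image_of_mem _ (by simpa using h)))))
  obtain ⟨σ, hσ, hht⟩ := codimSing_le_height_of_relation F hF hdim a
    (fun h => hyc (congrFun h i₀)) Q (fun i => hPQ (hFP i)) (c i₀) (hnotMem _ hyc) (by
      intro z hz hcz
      have hprop : ∀ i, a i₀ * eval z (c i) = a i * eval z (c i₀) := fun i => by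
        have := hz _ (hrel i)
        simpa [aeval_eq_eval, sub_eq_zero] using this
      ext j
      have h1 : ∑ i, eval z (c i) * eval z (pderiv j (F i : MvPolynomial (Fin N) K)) = 0 := by
        have := hz _ (hPQ (hc j))
        simpa [aeval_eq_eval] using this
      have h2 : eval z (c i₀) *
          ∑ i, a i * eval z (pderiv j (F i : MvPolynomial (Fin N) K)) = 0 := by
        rw [← mul_zero (a i₀), ← h1, Finset.mul_sum, Finset.mul_sum]
        refine Finset.sum_congr rfl fun i _ => ?_
        rw [← mul_assoc, ← mul_assoc, hprop i, mul_comm (a i)]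
      have h3 := (mul_eq_zero.1 h2).resolve_left hcz
      rw [map_sum, Finset.sum_apply, Pi.zero_apply, ← h3]
      exact Finset.sum_congr rfl fun i _ => by
        rw [map_smul, Pi.smul_apply, gradient_apply, smul_eq_mul])
  refine ⟨σ, hσ, hht.trans ((hf D Q hQ (hnotMem f hyf)).trans ?_)⟩
  gcongr

end SmallSubalgebras

theorem mainTheorem11 {K : Type*} [Field K] [IsAlgClosed K] (N n : ℕ)
    (V : Submodule K (MvPolynomial (Fin N) K))
    (F : Module.Basis (Fin n) K V)
    (hF : ∀ i, ∃ e : ℕ, 1 ≤ e ∧ (F i : MvPolynomial (Fin N) K).IsHomogeneous e)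
    (hreg : RingTheory.Sequence.IsRegular (MvPolynomial (Fin N) K)
      (List.ofFn fun i => (F i : MvPolynomial (Fin N) K))) :
    (⨅ σ ∈ SmallSubalgebras.distinctDegreeSets V, SmallSubalgebras.codimSing σ)
        - ((n : ℕ∞) - 1) ≤
      SmallSubalgebras.codimSing (Set.range fun i => (F i : MvPolynomial (Fin N) K)) := by
  have hdim := SmallSubalgebras.ringKrullDim_add_length_le_of_isWeaklyRegular _
    hreg.toIsWeaklyRegular
  have hlist : Ideal.ofList (List.ofFn fun i => (F i : MvPolynomial (Fin N) K)) =
      Ideal.span (Set.range fun i => (F i : MvPolynomial (Fin N) K)) := by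
    rw [Ideal.ofList]
    congr 1
    ext f
    simp
  rw [hlist, List.length_ofFn, MvPolynomial.ringKrullDim_of_isNoetherianRing,
    ringKrullDim_eq_zero_of_field, zero_add, Nat.card_eq_fintype_card, Fintype.card_fin] at hdim
  -- An empty singular locus has the unit ideal, with no minimal primes and height ⊤.
  rw [SmallSubalgebras.codimSing, SmallSubalgebras.codim, Ideal.height_eq_inf_minimalPrimes]
  refine le_iInf₂ fun P hP => tsub_le_iff_right.2 ?_
  have : P.IsPrime := hP.1.1
  obtain ⟨σ, hσ, hle⟩ := SmallSubalgebras.exists_codimSing_le_height_add F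
    (fun i => (hF i).imp fun _ h => h.2) hdim P hP.1.2
  -- Truncated subtraction agrees in ℕ and ℕ∞, including at n = 0.
  rw [← ENat.natCast_one, ← ENat.natCast_sub]
  exact (iInf₂_le σ hσ).trans hle
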